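/- Let $\mathcal{C}$ be the set of all closed convex curves in the plane $\mathbb{R}^2$, that is, of all boundaries of compact convex sets with nonempty interior, equipped with the Hausdorff metric. For $C\in\mathcal{C}$ let $C^o$ denote the closed convex set enclosed by $C$ (the compact convex set whose boundary is $C$). A tangent line to $C$ at a point $a\in C$ is a line through $a$ such that $C$ lies in one of the two closed half-planes bounded by it. A segment $[a,b]$ with $a,b\in C$ is an affine diameter of $C$ if there are distinct parallel tangent lines to $C$ at $a$ and at $b$. Theorem 1.3. For most convex curves $C$, most points of $C^o$ lie in continuum many affine diameters of $C$. That is, there is a comeagre set of curves $C\in\mathcal{C}$ such that, for each $C$ in it, the set of points $u\in C^o$ for which the set of affine diameters of $C$ containing $u$ has the cardinality of the continuum is comeagre in $C^o$. -/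

import Mathlib

/-- The Euclidean plane. -/
abbrev Plane : Type := EuclideanSpace ℝ (Fin 2)

/-- A closed convex curve in the plane: the boundary of a compact convex set with nonempty
interior. -/
def IsConvexCurve (C : Set Plane) : Prop :=
  ∃ K : Set Plane, IsCompact K ∧ Convex ℝ K ∧ (interior K).Nonempty ∧ frontier K = C

/-- The space of all closed convex curves in the plane. As a subtype of the nonempty compact
sets it carries the Hausdorff metric (between the curves themselves). -/
abbrev ConvexCurve : Type :=
  {C : TopologicalSpace.NonemptyCompacts Plane // IsConvexCurve (C : Set Plane)}

namespace ConvexCurve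

/-- The points of a convex curve. -/
def carrier (C : ConvexCurve) : Set Plane := (C.1 : Set Plane)

/-- The convex body `Cᵒ` enclosed by a convex curve `C`: the convex hull of `C`. By
`ConvexCurve.eq_body_iff` it is the unique compact convex set whose boundary is `C`. -/
def body (C : ConvexCurve) : Set Plane := convexHull ℝ C.carrier

/-- A compact convex set in the plane is the convex hull of its boundary. -/
theorem convexHull_frontier_eq {K : Set Plane} (hK : IsCompact K) (hc : Convex ℝ K) :
    convexHull ℝ (frontier K) = K := by
  apply Set.Subset.antisymm
  · exact convexHull_min hK.isClosed.frontier_subset hc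
  intro x hx
  obtain ⟨v, hv⟩ : ∃ v : Plane, v ≠ 0 := exists_ne 0
  -- along every direction the line through `x` leaves `K` through the boundary
  have key : ∀ w : Plane, w ≠ 0 → ∃ t : ℝ, 0 ≤ t ∧ x + t • w ∈ frontier K := by
    intro w hw
    have hcont : Continuous fun t : ℝ => x + t • w := by fun_prop
    obtain ⟨R, hR⟩ := hK.isBounded.exists_norm_le
    have hw' : 0 < ‖w‖ := norm_pos_iff.mpr hw
    obtain ⟨s, hs0, hs⟩ : ∃ s : ℝ, 0 ≤ s ∧ x + s • w ∉ K := by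
      refine ⟨(|R| + ‖x‖ + 1) / ‖w‖, by positivity, fun h => ?_⟩
      have h1 := hR _ h
      have h2 : ‖((|R| + ‖x‖ + 1) / ‖w‖) • w‖ = |R| + ‖x‖ + 1 := by
        rw [norm_smul, Real.norm_of_nonneg (by positivity)]
        field_simp
      have h3 := norm_sub_le (x + ((|R| + ‖x‖ + 1) / ‖w‖) • w) x
      rw [add_sub_cancel_left, h2] at h3
      linarith [le_abs_self R]
    have hpre : IsPreconnected ((fun t : ℝ => x + t • w) '' Set.Icc 0 s) :=
      isPreconnected_Icc.image _ hcont.continuousOn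
    by_contra hne
    push Not at hne
    have hcov : (fun t : ℝ => x + t • w) '' Set.Icc 0 s ⊆ interior K ∪ Kᶜ := by
      rintro _ ⟨t, ht, rfl⟩
      by_cases hK' : x + t • w ∈ K
      · left
        by_contra hint
        exact hne t ht.1 ⟨subset_closure hK', hint⟩
      · exact Or.inr hK'
    have hxi : x ∈ interior K := by
      by_contra hint
      exact hne 0 le_rfl (by simpa using ⟨subset_closure hx, hint⟩)
    obtain ⟨y, -, hy1, hy2⟩ := hpre _ _ isOpen_interior hK.isClosed.isOpen_compl hcov
      ⟨x, ⟨0, ⟨le_rfl, hs0⟩, by simp⟩, hxi⟩ ⟨_, ⟨s, ⟨hs0, le_rfl⟩, rfl⟩, hs⟩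
    exact hy2 (interior_subset hy1)
  obtain ⟨t, ht, h1⟩ := key v hv
  obtain ⟨s, hs, h2⟩ := key (-v) (neg_ne_zero.mpr hv)
  rcases eq_or_lt_of_le ht with rfl | ht'
  · exact subset_convexHull ℝ _ (by simpa using h1)
  have hst : 0 < s + t := by linarith
  have := (convex_convexHull ℝ (frontier K)) (subset_convexHull ℝ _ h1)
    (subset_convexHull ℝ _ h2) (a := s / (s + t)) (b := t / (s + t))
    (by positivity) (by positivity) (by field_simp)
  convert this using 1
  ext i
  simp only [PiLp.add_apply, PiLp.smul_apply, PiLp.neg_apply, smul_eq_mul]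
  field_simp
  ring

/-- `Cᵒ` is the unique compact convex set whose boundary is `C`. -/
theorem eq_body_iff (C : ConvexCurve) (K : Set Plane) :
    K = C.body ↔ IsCompact K ∧ Convex ℝ K ∧ frontier K = C.carrier := by
  constructor
  · rintro rfl
    obtain ⟨L, hL, hc, -, hf⟩ := C.2
    have : C.body = L := by
      rw [body, carrier, ← hf, convexHull_frontier_eq hL hc]
    rw [this]
    exact ⟨hL, hc, hf⟩
  · rintro ⟨hK, hc, hf⟩
    rw [body, ← hf, convexHull_frontier_eq hK hc]

/-- `L` is a tangent (that is, supporting) line to the curve `C` at the point `a` of `C`: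
a line through `a` such that `C` lies in one of the two closed half-planes bounded by `L`. -/
def IsTangentLine (C : ConvexCurve) (a : Plane) (L : AffineSubspace ℝ Plane) : Prop :=
  a ∈ C.carrier ∧ ∃ n : Plane, n ≠ 0 ∧
    (L : Set Plane) = {x | inner ℝ n x = inner ℝ n a} ∧
    ∀ x ∈ C.carrier, inner ℝ n x ≤ inner ℝ n a

/-- The set `S` is an affine diameter of `C`: it is a segment `[a, b]` such that there are distinct parallel tangent lines
to `C` at the points `a` and `b` of `C`. -/
def IsAffineDiameter (C : ConvexCurve) (S : Set Plane) : Prop :=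
  ∃ a b : Plane, S = segment ℝ a b ∧
    ∃ L M : AffineSubspace ℝ Plane,
      C.IsTangentLine a L ∧ C.IsTangentLine b M ∧ L ≠ M ∧ L.Parallel M

end ConvexCurve

namespace ConvexCurve

open Filter Topology Metric Set

/-! Fix `u` inside the body. For a direction `dir t`, a chord from the face in direction `dir t` to
the opposite face has a sign, that of `cross (a - u) (b - u)`, telling on which side it passes `u`;
sign zero means an affine diameter through `u`. Call `t` positive if all its chords are
(`ChordsAside` at `dir t`), negative if all are negative (`ChordsAside` at `-dir t`). Faces are
convex and upper semicontinuous, so an intermediate value theorem holds (`exists_mem_zeros`):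
between a negative and a positive direction lies a zero. Both strict conditions are open in the
curve and in `u`.

The key is a perturbation (`exists_dist_lt_chordsAside`). At a zero `t`, make one end of the
diameter a corner and the other an edge orthogonal to `dir t`. Turning through `t`, the chord keeps
the corner and jumps along the edge, so it is positive just before `t` and negative just after. A
change from negative to positive thereby contains two disjoint ones, with a reverse change between
them. The splitting is open, so for most curves it happens for all rational directions and all `u`
in a countable dense set, and then, by openness in `u`, for most `u`.

Iterating the splitting gives a Cantor scheme of zeros (`exists_separated_family`), any two
separated by a direction that is not a zero. A chord shared by two directions would also be a chord
for the directions between them, so separated zeros yield distinct diameters (`segment_ne_segment`).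
-/

/-- The set of points of `K` that are extremal in direction `n`. -/
def face (K : Set Plane) (n : Plane) : Set Plane :=
  {x | x ∈ K ∧ ∀ y ∈ K, inner ℝ n y ≤ inner ℝ n x}

/-- The determinant of two vectors of the plane. -/
def cross (p q : Plane) : ℝ := p 0 * q 1 - p 1 * q 0

/-- The unit vector of direction angle `π t`. -/
noncomputable def dir (t : ℝ) : Plane := !₂[Real.cos (Real.pi * t), Real.sin (Real.pi * t)]

/-- Every chord of `K` joining the faces in directions `n` and `-n` passes `u` on the same
(strict) side. -/
def ChordsAside (K : Set Plane) (u n : Plane) : Prop :=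
  ∀ a ∈ face K n, ∀ b ∈ face K (-n), 0 < cross (a - u) (b - u)

/-! ### Coordinates, the determinant and direction vectors -/

theorem inner_eq (x y : Plane) : inner ℝ x y = x 0 * y 0 + x 1 * y 1 := by
  simp [PiLp.inner_apply, Fin.sum_univ_two]; ring

theorem cross_swap (p q : Plane) : cross q p = -cross p q := by
  simp only [cross]; ring

theorem continuous_cross : Continuous fun p : Plane × Plane => cross p.1 p.2 := by
  unfold cross; fun_prop

theorem continuous_dir : Continuous dir := by
  unfold dir
  refine (PiLp.continuous_toLp 2 _).comp (continuous_pi fun i => ?_)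
  fin_cases i <;> simp <;> fun_prop

theorem dir_add_one (t : ℝ) : dir (t + 1) = -dir t := by
  ext i
  fin_cases i <;> simp [dir, mul_add, Real.cos_add_pi, Real.sin_add_pi]

theorem dir_ne_zero (t : ℝ) : dir t ≠ 0 := by
  intro h
  have h0 := congrArg (fun x : Plane => x 0) h
  have h1 := congrArg (fun x : Plane => x 1) h
  simp [dir] at h0 h1
  have := Real.sin_sq_add_cos_sq (Real.pi * t)
  rw [h0, h1] at this
  norm_num at this

/-- For `s ≤ r ≤ t < s + 1` the coefficients are nonnegative, which puts `dir r` in the cone spanned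
by `dir s` and `dir t`. -/
theorem sin_smul_dir (r s t : ℝ) :
    Real.sin (Real.pi * (t - s)) • dir r =
      Real.sin (Real.pi * (t - r)) • dir s + Real.sin (Real.pi * (r - s)) • dir t := by
  ext i
  fin_cases i <;> simp [dir, mul_sub, Real.sin_sub]
  all_goals ring

theorem sin_pi_mul_pos {x : ℝ} (h0 : 0 < x) (h1 : x < 1) : 0 < Real.sin (Real.pi * x) :=
  Real.sin_pos_of_pos_of_lt_pi (mul_pos Real.pi_pos h0) (mul_lt_of_lt_one_right Real.pi_pos h1)

/-! ### Faces -/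

theorem convex_face {K : Set Plane} (hK : Convex ℝ K) (n : Plane) : Convex ℝ (face K n) := by
  intro x hx y hy a b ha hb hab
  refine ⟨hK hx.1 hy.1 ha hb hab, fun z hz => ?_⟩
  rw [inner_add_right, inner_smul_right, inner_smul_right]
  have h1 := mul_le_mul_of_nonneg_left (hx.2 z hz) ha
  have h2 := mul_le_mul_of_nonneg_left (hy.2 z hz) hb
  have h3 : inner ℝ n z = a * inner ℝ n z + b * inner ℝ n z := by rw [← add_mul, hab, one_mul]
  linarith

theorem face_nonempty {K : Set Plane} (hK : IsCompact K) (hne : K.Nonempty) (n : Plane) :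
    (face K n).Nonempty := by
  obtain ⟨x, hx, hmax⟩ := hK.exists_isMaxOn hne (f := fun x => inner ℝ n x) (by fun_prop)
  exact ⟨x, hx, fun y hy => hmax hy⟩

theorem inner_lt_of_mem_interior {K : Set Plane} {n a u : Plane} (hn : n ≠ 0)
    (ha : ∀ y ∈ K, inner ℝ n y ≤ inner ℝ n a) (hu : u ∈ interior K) :
    inner ℝ n u < inner ℝ n a := by
  have hc : Tendsto (fun s : ℝ => u + s • n) (𝓝[>] 0) (𝓝 (u + (0 : ℝ) • n)) :=
    (by fun_prop : Continuous fun s : ℝ => u + s • n).continuousAt.tendsto.mono_left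
      nhdsWithin_le_nhds
  have hmem : ∀ᶠ s : ℝ in 𝓝[>] 0, u + s • n ∈ K :=
    hc (by simpa using mem_interior_iff_mem_nhds.mp hu)
  obtain ⟨s, hs, hs0⟩ := (hmem.and self_mem_nhdsWithin).exists
  have := ha _ hs
  rw [inner_add_right, inner_smul_right, real_inner_self_eq_norm_sq] at this
  have : 0 < s * ‖n‖ ^ 2 := mul_pos hs0 (by positivity)
  linarith

theorem mem_frontier_of_mem_face {K : Set Plane} {n a : Plane} (hn : n ≠ 0)
    (ha : a ∈ face K n) : a ∈ frontier K :=
  ⟨subset_closure ha.1, fun h => (inner_lt_of_mem_interior hn ha.2 h).false⟩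

/-- A point lying in two faces lies in all the faces in between. -/
theorem mem_face_of_le_of_le {K : Set Plane} {a : Plane} {r s t : ℝ} (hs : a ∈ face K (dir s))
    (ht : a ∈ face K (dir t)) (hsr : s ≤ r) (hrt : r ≤ t) (hts : t < s + 1) :
    a ∈ face K (dir r) := by
  rcases eq_or_lt_of_le (hsr.trans hrt) with h | h
  · rwa [le_antisymm (hrt.trans h.symm.le) hsr]
  refine ⟨hs.1, fun y hy => ?_⟩
  have hpi := Real.pi_pos
  have h0 : 0 < Real.sin (Real.pi * (t - s)) := sin_pi_mul_pos (by linarith) (by linarith)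
  have h1 : 0 ≤ Real.sin (Real.pi * (t - r)) :=
    Real.sin_nonneg_of_nonneg_of_le_pi (by nlinarith) (by nlinarith)
  have h2 : 0 ≤ Real.sin (Real.pi * (r - s)) :=
    Real.sin_nonneg_of_nonneg_of_le_pi (by nlinarith) (by nlinarith)
  have key : ∀ x, Real.sin (Real.pi * (t - s)) * inner ℝ (dir r) x =
      Real.sin (Real.pi * (t - r)) * inner ℝ (dir s) x +
        Real.sin (Real.pi * (r - s)) * inner ℝ (dir t) x := fun x => by
    rw [← real_inner_smul_left, ← real_inner_smul_left, ← real_inner_smul_left, ← inner_add_left,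
      ← sin_smul_dir]
  refine le_of_mul_le_mul_left ?_ h0
  rw [key, key]
  exact add_le_add (mul_le_mul_of_nonneg_left (hs.2 y hy) h1)
    (mul_le_mul_of_nonneg_left (ht.2 y hy) h2)

/-- If opposite boundary points are collinear with an interior point, then the segment joining
them contains it. -/
theorem exists_eq_of_cross_eq_zero {K : Set Plane} {n a b u : Plane} (hn : n ≠ 0)
    (ha : a ∈ face K n) (hb : b ∈ face K (-n)) (hu : u ∈ interior K)
    (h : cross (a - u) (b - u) = 0) :
    ∃ τ : ℝ, 0 < τ ∧ τ < 1 ∧ u = (1 - τ) • a + τ • b := by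
  have h1 := inner_lt_of_mem_interior hn ha.2 hu
  have h2 := inner_lt_of_mem_interior (neg_ne_zero.mpr hn) hb.2 hu
  rw [inner_neg_left, inner_neg_left] at h2
  simp only [inner_eq] at h1 h2
  simp only [cross, PiLp.sub_apply] at h
  set P := n 0 * a 0 + n 1 * a 1 - (n 0 * u 0 + n 1 * u 1) with hP
  set Q := n 0 * u 0 + n 1 * u 1 - (n 0 * b 0 + n 1 * b 1) with hQ
  have hP0 : 0 < P := by linarith
  have hQ0 : 0 < Q := by linarith
  -- The vector `Q • (a - u) + P • (b - u)` is orthogonal to `n` and, by `h`, parallel to `a - u`.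
  -- Since `P`, the inner product of `n` with `a - u`, is nonzero, the vector vanishes.
  have key0 : Q * (a 0 - u 0) + P * (b 0 - u 0) = 0 := by
    have : P * (Q * (a 0 - u 0) + P * (b 0 - u 0)) = 0 := by
      rw [hP, hQ]; linear_combination (-(n 1) * P) * h
    exact (mul_eq_zero.mp this).resolve_left hP0.ne'
  have key1 : Q * (a 1 - u 1) + P * (b 1 - u 1) = 0 := by
    have : P * (Q * (a 1 - u 1) + P * (b 1 - u 1)) = 0 := by
      rw [hP, hQ]; linear_combination (n 0 * P) * h
    exact (mul_eq_zero.mp this).resolve_left hP0.ne'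
  have hPQ : 0 < P + Q := by linarith
  refine ⟨P / (P + Q), by positivity, by rw [div_lt_one hPQ]; linarith, ?_⟩
  ext i
  fin_cases i
  · simp; field_simp; linarith
  · simp; field_simp; linarith

/-! ### The body of a curve -/

theorem isCompact_body (C : ConvexCurve) : IsCompact C.body := ((C.eq_body_iff _).mp rfl).1

theorem convex_body (C : ConvexCurve) : Convex ℝ C.body := ((C.eq_body_iff _).mp rfl).2.1

theorem frontier_body (C : ConvexCurve) : frontier C.body = C.carrier :=
  ((C.eq_body_iff _).mp rfl).2.2

theorem interior_body_nonempty (C : ConvexCurve) : (interior C.body).Nonempty := by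
  obtain ⟨L, hL, hc, hi, hf⟩ := C.2
  rwa [← (C.eq_body_iff L).mpr ⟨hL, hc, hf⟩]

theorem body_nonempty (C : ConvexCurve) : C.body.Nonempty :=
  C.interior_body_nonempty.mono interior_subset

/-- A thickening of a convex set is convex, so closeness of the curves passes to their hulls. -/
theorem body_subset_thickening {C D : ConvexCurve} {ε : ℝ} (h : dist C D < ε) :
    C.body ⊆ thickening ε D.body := by
  refine convexHull_min ?_ (D.convex_body.thickening ε)
  intro x hx
  obtain ⟨y, hy, hxy⟩ := exists_dist_lt_of_hausdorffDist_lt (s := (C.1 : Set Plane))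
    (t := (D.1 : Set Plane)) hx h
    (hausdorffEDist_ne_top_of_nonempty_of_bounded C.1.nonempty D.1.nonempty
      C.1.isCompact.isBounded D.1.isCompact.isBounded)
  exact mem_thickening_iff.mpr ⟨y, subset_convexHull ℝ _ hy, hxy⟩

/-- Upper semicontinuity of faces. -/
theorem exists_subseq_tendsto_face {C : ℕ → ConvexCurve} {D : ConvexCurve} {n : ℕ → Plane}
    {m : Plane} {a : ℕ → Plane} (hC : Tendsto C atTop (𝓝 D)) (hn : Tendsto n atTop (𝓝 m))
    (ha : ∀ k, a k ∈ face (C k).body (n k)) :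
    ∃ x ∈ face D.body m, ∃ φ : ℕ → ℕ, StrictMono φ ∧ Tendsto (a ∘ φ) atTop (𝓝 x) := by
  have hdist : ∀ ε > 0, ∀ᶠ k in atTop, dist (C k) D < ε := fun ε hε => Metric.tendsto_nhds.mp hC ε hε
  obtain ⟨x, -, φ, hφ, hx⟩ := tendsto_subseq_of_frequently_bounded
    (D.isCompact_body.isBounded.thickening (δ := 1)) (x := a)
    ((hdist 1 one_pos).mono fun k hk => body_subset_thickening hk (ha k).1).frequently
  refine ⟨x, ⟨?_, fun y hy => ?_⟩, φ, hφ, hx⟩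
  · rw [← D.isCompact_body.isClosed.closure_eq, closure_eq_iInter_thickening]
    refine mem_iInter₂.mpr fun ε hε => ?_
    have hε2 : 0 < ε / 2 := by positivity
    obtain ⟨k, hk1, hk2⟩ := ((hφ.tendsto_atTop.eventually (hdist _ hε2)).and
      (Metric.tendsto_nhds.mp hx _ hε2)).exists
    obtain ⟨y, hy, hay⟩ := mem_thickening_iff.mp (body_subset_thickening hk1 (ha _).1)
    refine mem_thickening_iff.mpr ⟨y, hy, ?_⟩
    have := dist_triangle_left x y (a (φ k))
    simp only [Function.comp] at hk2
    linarith
  -- Every `y` in the limit body is a limit of points `z k` of the bodies `C k`, so maximality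
  -- passes to the limit. The term `1 / (k + 1)` only makes the inequality strict.
  · have hex : ∀ k, ∃ z ∈ (C k).body, dist z y ≤ dist (C k) D + 1 / ((k : ℝ) + 1) := by
      intro k
      have hlt : dist D (C k) < dist (C k) D + 1 / ((k : ℝ) + 1) := by
        rw [dist_comm]
        have : 0 < 1 / ((k : ℝ) + 1) := by positivity
        linarith
      obtain ⟨z, hz, hzy⟩ := mem_thickening_iff.mp (body_subset_thickening hlt hy)
      exact ⟨z, hz, by rw [dist_comm]; exact hzy.le⟩
    choose z hz hzy using hex
    have hz0 : Tendsto z atTop (𝓝 y) := by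
      rw [tendsto_iff_dist_tendsto_zero]
      refine squeeze_zero (fun _ => dist_nonneg) hzy ?_
      simpa using (tendsto_iff_dist_tendsto_zero.mp hC).add
        (tendsto_one_div_add_atTop_nhds_zero_nat (𝕜 := ℝ))
    have hn' := hn.comp hφ.tendsto_atTop
    exact le_of_tendsto_of_tendsto' (hn'.inner (hz0.comp hφ.tendsto_atTop)) (hn'.inner hx)
      fun k => (ha (φ k)).2 _ (hz (φ k))

/-- Compactness of faces under limits lets both ends of the chord converge along a common
subsequence. The set `T` is general because the cases `≤ 0`, `≥ 0` and `= 0` are all needed. -/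
theorem isClosed_setOf_exists_cross_mem {T : Set ℝ} (hT : IsClosed T) :
    IsClosed {p : ConvexCurve × Plane × Plane | ∃ a ∈ face p.1.body p.2.2,
      ∃ b ∈ face p.1.body (-p.2.2), cross (a - p.2.1) (b - p.2.1) ∈ T} := by
  refine IsSeqClosed.isClosed fun p q hp hpq => ?_
  choose a ha b hb hab using hp
  have hC : Tendsto (fun k => (p k).1) atTop (𝓝 q.1) := (continuous_fst.tendsto q).comp hpq
  have hu : Tendsto (fun k => (p k).2.1) atTop (𝓝 q.2.1) :=
    ((continuous_fst.comp continuous_snd).tendsto q).comp hpq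
  have hn : Tendsto (fun k => (p k).2.2) atTop (𝓝 q.2.2) :=
    ((continuous_snd.comp continuous_snd).tendsto q).comp hpq
  obtain ⟨x, hx, φ, hφ, hax⟩ := exists_subseq_tendsto_face hC hn ha
  obtain ⟨y, hy, ψ, hψ, hby⟩ := exists_subseq_tendsto_face (hC.comp hφ.tendsto_atTop)
    (hn.neg.comp hφ.tendsto_atTop) (a := b ∘ φ) fun k => hb (φ k)
  refine ⟨x, hx, y, hy, hT.mem_of_tendsto (b := atTop)
    (f := fun k => cross (a (φ (ψ k)) - (p (φ (ψ k))).2.1) (b (φ (ψ k)) - (p (φ (ψ k))).2.1)) ?_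
    (Eventually.of_forall fun k => hab _)⟩
  have hu' := hu.comp (hφ.comp hψ).tendsto_atTop
  exact (continuous_cross.tendsto (x - q.2.1, y - q.2.1)).comp
    (((hax.comp hψ.tendsto_atTop).sub hu').prodMk_nhds (hby.sub hu'))

theorem isOpen_setOf_chordsAside :
    IsOpen {p : ConvexCurve × Plane × Plane | ChordsAside p.1.body p.2.1 p.2.2} := by
  have := (isClosed_setOf_exists_cross_mem (isClosed_Iic (a := (0 : ℝ)))).isOpen_compl
  convert this using 1
  ext p
  simp [ChordsAside]

/-! ### Zeros between sign changes -/

/-- The directions of the affine diameters whose lines contain `u`. -/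
def zeros (C : ConvexCurve) (u : Plane) : Set ℝ :=
  {t | ∃ a ∈ face C.body (dir t), ∃ b ∈ face C.body (-dir t), cross (a - u) (b - u) = 0}

theorem isClosed_setOf_exists_cross_dir_mem (C : ConvexCurve) (u : Plane) {T : Set ℝ}
    (hT : IsClosed T) :
    IsClosed {t : ℝ | ∃ a ∈ face C.body (dir t), ∃ b ∈ face C.body (-dir t),
      cross (a - u) (b - u) ∈ T} :=
  (isClosed_setOf_exists_cross_mem hT).preimage
    (f := fun t : ℝ => ((C, u, dir t) : ConvexCurve × Plane × Plane))
    (continuous_const.prodMk (continuous_const.prodMk continuous_dir))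

theorem isClosed_zeros (C : ConvexCurve) (u : Plane) : IsClosed (C.zeros u) :=
  C.isClosed_setOf_exists_cross_dir_mem u (isClosed_singleton (x := (0 : ℝ)))

theorem exists_mem_zeros {C : ConvexCurve} {u : Plane} {s t : ℝ} (hst : s ≤ t)
    (hs : ∃ a ∈ face C.body (dir s), ∃ b ∈ face C.body (-dir s), cross (a - u) (b - u) ≤ 0)
    (ht : ∃ a ∈ face C.body (dir t), ∃ b ∈ face C.body (-dir t), 0 ≤ cross (a - u) (b - u)) :
    ∃ r ∈ Icc s t, r ∈ C.zeros u := by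
  obtain ⟨r, hr, ⟨a, ha, b, hb, hab⟩, a', ha', b', hb', hab'⟩ :=
    isPreconnected_closed_iff.mp (isPreconnected_Icc (a := s) (b := t)) _ _
      (C.isClosed_setOf_exists_cross_dir_mem u isClosed_Iic)
      (C.isClosed_setOf_exists_cross_dir_mem u isClosed_Ici) (fun r _ => by
        obtain ⟨a, ha⟩ := face_nonempty C.isCompact_body C.body_nonempty (dir r)
        obtain ⟨b, hb⟩ := face_nonempty C.isCompact_body C.body_nonempty (-dir r)
        rcases le_total (cross (a - u) (b - u)) 0 with h | h
        · exact Or.inl ⟨a, ha, b, hb, h⟩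
        · exact Or.inr ⟨a, ha, b, hb, h⟩)
      ⟨s, left_mem_Icc.mpr hst, hs⟩ ⟨t, right_mem_Icc.mpr hst, ht⟩
  refine ⟨r, hr, ?_⟩
  -- At `r` there are chords of both weak signs. Pairs of end points form a convex set, so some
  -- chord between them has sign zero.
  have hpre : IsPreconnected (face C.body (dir r) ×ˢ face C.body (-dir r)) :=
    ((convex_face C.convex_body _).prod (convex_face C.convex_body _)).isPreconnected
  obtain ⟨p, hp, h0⟩ := hpre.intermediate_value (a := (a, b)) (b := (a', b')) ⟨ha, hb⟩ ⟨ha', hb'⟩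
    (f := fun p => cross (p.1 - u) (p.2 - u))
    (continuous_cross.comp (by fun_prop : Continuous fun p : Plane × Plane =>
      (p.1 - u, p.2 - u))).continuousOn ⟨hab, hab'⟩
  exact ⟨p.1, hp.1, p.2, hp.2, h0⟩

theorem ChordsAside.exists_cross_nonneg {C : ConvexCurve} {u : Plane} {t : ℝ}
    (h : ChordsAside C.body u (dir t)) :
    ∃ a ∈ face C.body (dir t), ∃ b ∈ face C.body (-dir t), 0 ≤ cross (a - u) (b - u) := by
  obtain ⟨a, ha⟩ := face_nonempty C.isCompact_body C.body_nonempty (dir t)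
  obtain ⟨b, hb⟩ := face_nonempty C.isCompact_body C.body_nonempty (-dir t)
  exact ⟨a, ha, b, hb, (h a ha b hb).le⟩

theorem ChordsAside.cross_neg {K : Set Plane} {u n : Plane} (h : ChordsAside K u (-n))
    {a b : Plane} (ha : a ∈ face K n) (hb : b ∈ face K (-n)) : cross (a - u) (b - u) < 0 := by
  have := h b hb a (by rwa [neg_neg])
  rw [cross_swap] at this
  linarith

theorem ChordsAside.exists_cross_nonpos {C : ConvexCurve} {u : Plane} {t : ℝ}
    (h : ChordsAside C.body u (-dir t)) :
    ∃ a ∈ face C.body (dir t), ∃ b ∈ face C.body (-dir t), cross (a - u) (b - u) ≤ 0 := by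
  obtain ⟨a, ha⟩ := face_nonempty C.isCompact_body C.body_nonempty (dir t)
  obtain ⟨b, hb⟩ := face_nonempty C.isCompact_body C.body_nonempty (-dir t)
  exact ⟨a, ha, b, hb, (h.cross_neg ha hb).le⟩

/-- A half turn swaps the two ends of a chord and so reverses its sign. The half turn is taken
forwards or backwards so that the sign goes from nonpositive to nonnegative. -/
theorem zeros_nonempty (C : ConvexCurve) (u : Plane) : (C.zeros u).Nonempty := by
  obtain ⟨a, ha⟩ := face_nonempty C.isCompact_body C.body_nonempty (dir 0)
  obtain ⟨b, hb⟩ := face_nonempty C.isCompact_body C.body_nonempty (-dir 0)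
  have e1 : dir 1 = -dir 0 := by rw [← dir_add_one, zero_add]
  have e2 : dir (-1) = -dir 0 := by
    rw [← neg_neg (dir (-1)), ← dir_add_one]; norm_num
  rcases le_total (cross (a - u) (b - u)) 0 with h | h
  · obtain ⟨r, -, hr⟩ := exists_mem_zeros (C := C) (u := u) zero_le_one ⟨a, ha, b, hb, h⟩
      ⟨b, e1 ▸ hb, a, by rwa [e1, neg_neg], by rw [cross_swap]; linarith⟩
    exact ⟨r, hr⟩
  · obtain ⟨r, -, hr⟩ := exists_mem_zeros (C := C) (u := u) (s := -1) (t := 0) (by norm_num)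
      ⟨b, e2 ▸ hb, a, by rwa [e2, neg_neg], by rw [cross_swap]; linarith⟩ ⟨a, ha, b, hb, h⟩
    exact ⟨r, hr⟩

/-! ### Perturbing a curve -/

theorem isCompact_convexHull_insert {S : Set Plane} (hS : IsCompact (convexHull ℝ S))
    (hne : S.Nonempty) (x : Plane) : IsCompact (convexHull ℝ (insert x S)) := by
  have : convexHull ℝ (insert x S) =
      (fun p : ℝ × Plane => (1 - p.1) • x + p.1 • p.2) '' (Icc 0 1 ×ˢ convexHull ℝ S) := by
    rw [convexHull_insert hne]
    ext y
    simp only [mem_convexJoin, mem_singleton_iff, exists_eq_left, segment_eq_image, mem_image,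
      mem_prod, Prod.exists]
    constructor
    · rintro ⟨z, hz, t, ht, rfl⟩
      exact ⟨t, z, ⟨ht, hz⟩, rfl⟩
    · rintro ⟨t, z, ⟨ht, hz⟩, rfl⟩
      exact ⟨z, hz, t, ht, rfl⟩
  rw [this]
  exact (isCompact_Icc.prod hS).image (by fun_prop)

theorem exists_mem_frontier_of_mem_of_notMem {K : Set Plane} {x y : Plane} (hx : x ∉ interior K)
    (hy : y ∈ K) : ∃ z ∈ frontier K, dist x z ≤ dist x y := by
  have hseg : ∃ z ∈ segment ℝ x y, z ∈ closure K ∩ closure Kᶜ :=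
    isPreconnected_closed_iff.mp (convex_segment x y).isPreconnected _ _ isClosed_closure
      isClosed_closure (fun z _ => by
        by_cases hz : z ∈ K
        · exact Or.inl (subset_closure hz)
        · exact Or.inr (subset_closure hz))
      ⟨y, right_mem_segment ℝ x y, subset_closure hy⟩
      ⟨x, left_mem_segment ℝ x y, by rwa [closure_compl]⟩
  obtain ⟨z, hz, hzK⟩ := hseg
  refine ⟨z, by rwa [frontier_eq_closure_inter_closure], ?_⟩
  have := dist_add_dist_of_mem_segment hz
  have := dist_nonneg (x := z) (y := y)
  linarith

theorem exists_mem_face_of_mem_frontier {K : Set Plane} (hK : IsCompact K) (hc : Convex ℝ K)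
    (hi : (interior K).Nonempty) {x : Plane} (hx : x ∈ frontier K) :
    ∃ n : Plane, ‖n‖ = 1 ∧ x ∈ face K n := by
  obtain ⟨f, hf⟩ := geometric_hahn_banach_open_point hc.interior isOpen_interior hx.2
  set m := (InnerProductSpace.toDual ℝ Plane).symm f with hm
  have hmf : ∀ y, inner ℝ m y = f y := fun y => by
    rw [hm, InnerProductSpace.toDual_symm_apply]
  have hm0 : m ≠ 0 := by
    intro h
    obtain ⟨y, hy⟩ := hi
    have h1 := hf y hy
    rw [← hmf, ← hmf, h] at h1
    simp at h1
  have hle : ∀ y ∈ K, inner ℝ m y ≤ inner ℝ m x := by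
    intro y hy
    have hy' : y ∈ closure (interior K) := by
      rw [hc.closure_interior_eq_closure_of_nonempty_interior hi]
      exact subset_closure hy
    refine closure_minimal (t := {y | inner ℝ m y ≤ inner ℝ m x}) (fun z hz => ?_)
      (isClosed_le (by fun_prop) (by fun_prop)) hy'
    simpa only [mem_ofPred_eq, hmf] using (hf z hz).le
  refine ⟨‖m‖⁻¹ • m, ?_, hK.isClosed.frontier_subset hx, fun y hy => ?_⟩
  · rw [norm_smul, norm_inv, norm_norm, inv_mul_cancel₀ (norm_ne_zero_iff.mpr hm0)]
  · rw [real_inner_smul_left, real_inner_smul_left]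
    exact mul_le_mul_of_nonneg_left (hle y hy) (by positivity)

/-- Nested bodies that are close have close boundaries. -/
theorem dist_le_of_body_subset {C D : ConvexCurve} {η : ℝ} (hCD : C.body ⊆ D.body)
    (hDC : D.body ⊆ thickening η C.body) : dist D C ≤ η := by
  have hη : 0 ≤ η := by
    obtain ⟨x, hx⟩ := D.body_nonempty
    obtain ⟨y, -, hy⟩ := mem_thickening_iff.mp (hDC hx)
    exact dist_nonneg.trans hy.le
  refine hausdorffDist_le_of_mem_dist (s := D.carrier) (t := C.carrier) hη ?_ ?_
  · intro x hx
    rw [← frontier_body] at hx ⊢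
    obtain ⟨y, hy, hxy⟩ := mem_thickening_iff.mp (hDC (D.isCompact_body.isClosed.frontier_subset hx))
    obtain ⟨z, hz, hxz⟩ := exists_mem_frontier_of_mem_of_notMem
      (fun h => hx.2 (interior_mono hCD h)) hy
    exact ⟨z, hz, hxz.trans hxy.le⟩
  · intro x hx
    rw [← frontier_body] at hx ⊢
    obtain ⟨n, hn, hxn⟩ := exists_mem_face_of_mem_frontier C.isCompact_body C.convex_body
      C.interior_body_nonempty hx
    -- The point lies at height `η` above the supporting line of `C` at `x`, out of reach of the
    -- open `η`-thickening. The segment to it therefore meets the boundary of `D`.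
    have hout : x + η • n ∉ D.body := by
      intro h
      obtain ⟨y, hy, hxy⟩ := mem_thickening_iff.mp (hDC h)
      have h1 := hxn.2 y hy
      have h2 := real_inner_le_norm n (x + η • n - y)
      rw [inner_sub_right, inner_add_right, inner_smul_right, real_inner_self_eq_norm_sq, hn,
        ← dist_eq_norm] at h2
      linarith
    obtain ⟨z, hz, hzd⟩ := exists_mem_frontier_of_mem_of_notMem (K := D.bodyᶜ) (x := x)
      (y := x + η • n) (by rw [interior_compl]; exact fun h => h (subset_closure (hCD hxn.1))) hout
    refine ⟨z, by rwa [frontier_compl] at hz, hzd.trans ?_⟩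
    rw [dist_self_add_right, norm_smul, hn, mul_one, Real.norm_of_nonneg hη]

theorem exists_body_eq {K : Set Plane} (hK : IsCompact K) (hc : Convex ℝ K)
    (hi : (interior K).Nonempty) : ∃ C : ConvexCurve, C.body = K := by
  have hne : (frontier K).Nonempty := by
    obtain ⟨x, hx⟩ := face_nonempty hK (hi.mono interior_subset) (dir 0)
    exact ⟨x, mem_frontier_of_mem_face (dir_ne_zero 0) hx⟩
  refine ⟨⟨⟨⟨frontier K, hK.of_isClosed_subset isClosed_frontier hK.isClosed.frontier_subset⟩,
    hne⟩, K, hK, hc, hi, rfl⟩, ?_⟩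
  exact convexHull_frontier_eq hK hc

/-- An open half-plane together with one point of its bounding line is convex, so strict maximality
on `S` extends to the hull. -/
theorem face_convexHull_subset {S : Set Plane} {n x : Plane}
    (h : ∀ y ∈ S, y ≠ x → inner ℝ n y < inner ℝ n x) (hx : x ∈ S) :
    face (convexHull ℝ S) n ⊆ {x} := by
  have hconv : Convex ℝ {y : Plane | y = x ∨ inner ℝ n y < inner ℝ n x} := by
    refine convex_iff_forall_pos.mpr fun y hy z hz a b ha hb hab => ?_
    have hx' : inner ℝ n x = a * inner ℝ n x + b * inner ℝ n x := by rw [← add_mul, hab, one_mul]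
    simp only [mem_ofPred_eq, inner_add_right, inner_smul_right]
    rcases hy with rfl | hy <;> rcases hz with rfl | hz
    · exact Or.inl (by rw [← add_smul, hab, one_smul])
    all_goals right; nlinarith
  intro y hy
  have := convexHull_min (fun z hz => or_iff_not_imp_left.mpr (h z hz)) hconv hy.1
  rcases this with h1 | h1
  · exact h1
  · exact absurd (hy.2 x (subset_convexHull ℝ S hx)) (not_le.mpr h1)

theorem eventually_forall_inner_lt {K : Set Plane} (hK : IsCompact K) {m x : Plane}
    (h : ∀ y ∈ K, inner ℝ m y < inner ℝ m x) :
    ∀ᶠ n in 𝓝 m, ∀ y ∈ K, inner ℝ n y < inner ℝ n x := by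
  refine hK.eventually_forall_of_forall_eventually fun y hy => ?_
  exact (isOpen_lt (f := fun z : Plane × Plane => inner ℝ z.1 z.2)
    (g := fun z : Plane × Plane => inner ℝ z.1 x) (by fun_prop) (by fun_prop)).mem_nhds (h y hy)

theorem norm_dir (t : ℝ) : ‖dir t‖ = 1 := by
  rw [EuclideanSpace.norm_eq]
  simp [dir, Fin.sum_univ_two]

theorem inner_dir_dir_add_half (s t : ℝ) :
    inner ℝ (dir s) (dir (t + 1 / 2)) = Real.sin (Real.pi * (s - t)) := by
  have h : Real.pi * (t + 1 / 2) = Real.pi * t + Real.pi / 2 := by ring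
  rw [inner_eq, dir, dir, h, Real.cos_add_pi_div_two, Real.sin_add_pi_div_two, mul_sub,
    Real.sin_sub]
  simp
  ring

theorem cross_dir_add_half (v : Plane) (t : ℝ) :
    cross v (dir (t + 1 / 2)) = inner ℝ (dir t) v := by
  have h : Real.pi * (t + 1 / 2) = Real.pi * t + Real.pi / 2 := by ring
  rw [inner_eq, cross, dir, dir, h, Real.cos_add_pi_div_two, Real.sin_add_pi_div_two]
  simp
  ring

/-- Near an affine diameter through `u`, an arbitrarily small perturbation of the curve, which
makes one end of the diameter a corner and the other end an edge, creates a sign change of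
prescribed type. -/
theorem exists_dist_lt_chordsAside {C : ConvexCurve} {u : Plane} (hu : u ∈ interior C.body)
    {t : ℝ} (ht : t ∈ C.zeros u) {ε κ : ℝ} (hε : 0 < ε) (hκ : 0 < κ) :
    ∃ D : ConvexCurve, dist D C < ε ∧ ∃ γ δ : ℚ, t - κ < γ ∧ (γ : ℝ) < t ∧ t < δ ∧ δ < t + κ ∧
      ChordsAside D.body u (dir γ) ∧ ChordsAside D.body u (-dir δ) := by
  obtain ⟨a, ha, b, hb, hab⟩ := ht
  obtain ⟨τ, hτ0, hτ1, huτ⟩ := exists_eq_of_cross_eq_zero (dir_ne_zero t) ha hb hu hab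
  set v := a - b with hv
  set e := dir (t + 1 / 2) with he
  have hw : 0 < inner ℝ (dir t) v := by
    have h1 := inner_lt_of_mem_interior (dir_ne_zero t) ha.2 hu
    have h2 := inner_lt_of_mem_interior (neg_ne_zero.mpr (dir_ne_zero t)) hb.2 hu
    rw [inner_neg_left, inner_neg_left] at h2
    rw [hv, inner_sub_right]
    linarith
  have hv0 : 0 < ‖v‖ + 1 := by positivity
  obtain ⟨η, hη, hηε⟩ : ∃ η : ℝ, 0 < η ∧ η * (‖v‖ + 1) < ε / 2 := by
    refine ⟨ε / 4 / (‖v‖ + 1), by positivity, ?_⟩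
    rw [div_mul_cancel₀ _ hv0.ne']
    linarith
  have hηw : 0 < η * inner ℝ (dir t) v := mul_pos hη hw
  -- The corner `p` and the midpoint `q 0` of the new edge from `q (-1)` to `q 1` lie on the line of
  -- the old diameter, beyond its ends; the edge is orthogonal to `dir t`.
  set p := a + η • v with hp
  set q : ℝ → Plane := fun σ => b - η • v + (σ * η) • e with hq
  have hinq : ∀ s σ, inner ℝ (dir s) (q σ) = inner ℝ (dir s) b - η * inner ℝ (dir s) v +
      σ * η * Real.sin (Real.pi * (s - t)) := fun s σ => by
    simp only [hq, he, inner_add_right, inner_sub_right, inner_smul_right, inner_dir_dir_add_half]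
  have hint : ∀ σ, inner ℝ (dir t) (q σ) = inner ℝ (dir t) b - η * inner ℝ (dir t) v := fun σ => by
    rw [hinq]; simp
  have hpt : inner ℝ (dir t) p = inner ℝ (dir t) a + η * inner ℝ (dir t) v := by
    rw [hp, inner_add_right, inner_smul_right]
  have hvt : inner ℝ (dir t) v = inner ℝ (dir t) a - inner ℝ (dir t) b := by
    rw [hv, inner_sub_right]
  have hKle := ha.2
  have hKge : ∀ y ∈ C.body, inner ℝ (dir t) b ≤ inner ℝ (dir t) y := fun y hy => by
    have := hb.2 y hy
    rw [inner_neg_left, inner_neg_left] at this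
    linarith
  set S := insert p (insert (q 1) (insert (q (-1)) C.body)) with hS
  have hKS : C.body ⊆ S := fun y hy => by simp [hS, hy]
  have hcompact : IsCompact (convexHull ℝ S) := by
    refine isCompact_convexHull_insert (isCompact_convexHull_insert (isCompact_convexHull_insert ?_
      C.body_nonempty _) (insert_nonempty _ _) _) (insert_nonempty _ _) _
    rw [C.convex_body.convexHull_eq]
    exact C.isCompact_body
  have hKh : C.body ⊆ convexHull ℝ S := hKS.trans (subset_convexHull ℝ S)
  obtain ⟨D, hD⟩ := exists_body_eq hcompact (convex_convexHull ℝ S)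
    (C.interior_body_nonempty.mono (interior_mono hKh))
  have hDC : D.body ⊆ thickening (ε / 2) C.body := by
    rw [hD]
    refine convexHull_min ?_ (C.convex_body.thickening _)
    have hqb : ∀ σ : ℝ, |σ| = 1 → q σ ∈ thickening (ε / 2) C.body := fun σ hσ => by
      refine mem_thickening_iff.mpr ⟨b, hb.1, lt_of_le_of_lt ?_ hηε⟩
      have : q σ - b = (σ * η) • e - η • v := by simp only [hq]; abel
      rw [dist_eq_norm, this]
      refine (norm_sub_le _ _).trans ?_
      rw [norm_smul, norm_smul, norm_mul, Real.norm_eq_abs, hσ, Real.norm_of_nonneg hη.le, he,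
        norm_dir]
      linarith
    refine insert_subset ?_ (insert_subset (hqb 1 (by simp)) (insert_subset (hqb (-1) (by simp))
      (self_subset_thickening (by positivity) _)))
    refine mem_thickening_iff.mpr ⟨a, ha.1, lt_of_le_of_lt ?_ hηε⟩
    rw [hp, dist_self_add_left, norm_smul, Real.norm_of_nonneg hη.le]
    nlinarith [norm_nonneg v]
  have hdist : dist D C < ε :=
    lt_of_le_of_lt (dist_le_of_body_subset (hD ▸ hKh) hDC) (by linarith)
  -- the corner is extremal for all directions near `dir t`
  have ev1 : ∀ᶠ s in 𝓝 t, ∀ y ∈ insert (q 1) (insert (q (-1)) C.body),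
      inner ℝ (dir s) y < inner ℝ (dir s) p := by
    refine continuous_dir.continuousAt.eventually (eventually_forall_inner_lt
      ((C.isCompact_body.insert _).insert _) ?_)
    rintro y (rfl | rfl | hy)
    · rw [hint]; linarith
    · rw [hint]; linarith
    · have := hKle y hy; linarith
  have ev2 : ∀ σ, ∀ᶠ s in 𝓝 t, ∀ y ∈ insert p C.body,
      inner ℝ (-dir s) y < inner ℝ (-dir s) (q σ) := by
    intro σ
    refine continuous_dir.neg.continuousAt.eventually (eventually_forall_inner_lt
      (C.isCompact_body.insert _) ?_)
    rintro y (rfl | hy) <;> rw [Pi.neg_apply, inner_neg_left, inner_neg_left, hint]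
    · linarith
    · have := hKge y hy; linarith
  obtain ⟨r, hr, hall⟩ := Metric.eventually_nhds_iff.mp (ev1.and ((ev2 1).and (ev2 (-1))))
  -- The bound `r` keeps `p` and the edge extremal, `κ` meets the prescribed width, and `1` keeps
  -- the sines below positive.
  set ρ := min r (min κ 1) with hρ
  have hρ0 : 0 < ρ := lt_min hr (lt_min hκ one_pos)
  have hρr : ρ ≤ r := min_le_left _ _
  have hρκ : ρ ≤ κ := (min_le_right _ _).trans (min_le_left _ _)
  have hρ1 : ρ ≤ 1 := (min_le_right _ _).trans (min_le_right _ _)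
  obtain ⟨γ, hγ1, hγ2⟩ := exists_rat_btwn (show t - ρ < t by linarith)
  obtain ⟨δ, hδ1, hδ2⟩ := exists_rat_btwn (show t < t + ρ by linarith)
  have hγr : dist (γ : ℝ) t < r := by
    rw [Real.dist_eq, abs_lt]; constructor <;> linarith
  have hδr : dist (δ : ℝ) t < r := by
    rw [Real.dist_eq, abs_lt]; constructor <;> linarith
  have hsinγ : 0 < η * Real.sin (Real.pi * (t - γ)) :=
    mul_pos hη (sin_pi_mul_pos (by linarith) (by linarith))
  have hsinγ' : Real.sin (Real.pi * (γ - t)) = -Real.sin (Real.pi * (t - γ)) := by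
    rw [← Real.sin_neg, ← mul_neg, neg_sub]
  have hsinδ : 0 < η * Real.sin (Real.pi * (δ - t)) :=
    mul_pos hη (sin_pi_mul_pos (by linarith) (by linarith))
  have hfp : ∀ s : ℝ, dist s t < r → face D.body (dir s) ⊆ {p} := fun s hs => by
    rw [hD]
    refine face_convexHull_subset (fun y hy hne => ?_) (mem_insert _ _)
    exact (hall hs).1 y (hy.resolve_left hne)
  -- Off `t` the tie between the ends of the edge is broken by the sign of the sine: `q 1` wins
  -- before `t`, `q (-1)` after it.
  have hfq1 : face D.body (-dir γ) ⊆ {q 1} := by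
    rw [hD]
    refine face_convexHull_subset (fun y hy hne => ?_) (by simp [hS])
    rcases hy with rfl | rfl | rfl | hy
    · exact (hall hγr).2.1 _ (mem_insert _ _)
    · exact absurd rfl hne
    · rw [inner_neg_left, inner_neg_left, hinq, hinq, hsinγ']; linarith
    · exact (hall hγr).2.1 _ (mem_insert_of_mem _ hy)
  have hfq2 : face D.body (-dir δ) ⊆ {q (-1)} := by
    rw [hD]
    refine face_convexHull_subset (fun y hy hne => ?_) (by simp [hS])
    rcases hy with rfl | rfl | rfl | hy
    · exact (hall hδr).2.2 _ (mem_insert _ _)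
    · rw [inner_neg_left, inner_neg_left, hinq, hinq]; linarith
    · exact absurd rfl hne
    · exact (hall hδr).2.2 _ (mem_insert_of_mem _ hy)
  -- Here `p - u = (τ + η) • v`, so only the component of `q σ - u` along `e` contributes.
  have hcross : ∀ σ, cross (p - u) (q σ - u) = σ * ((τ + η) * η * inner ℝ (dir t) v) := by
    intro σ
    rw [← cross_dir_add_half, ← he, huτ]
    simp only [cross, hp, hq, hv, PiLp.add_apply, PiLp.sub_apply, PiLp.smul_apply, smul_eq_mul]
    ring
  have hpos : 0 < (τ + η) * η * inner ℝ (dir t) v := by positivity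
  refine ⟨D, hdist, γ, δ, by linarith, hγ2, hδ1, by linarith, ?_, ?_⟩
  · intro x hx y hy
    rw [hfp _ hγr hx, hfq1 hy, hcross]
    linarith
  · intro y hy x hx
    rw [neg_neg] at hx
    rw [hfp _ hδr hx, hfq2 hy, cross_swap, hcross]
    linarith

/-! ### Affine diameters -/

theorem isAffineDiameter_segment {C : ConvexCurve} {n a b : Plane} (hn : n ≠ 0)
    (ha : a ∈ face C.body n) (hb : b ∈ face C.body (-n)) : C.IsAffineDiameter (segment ℝ a b) := by
  have hsub : C.carrier ⊆ C.body := subset_convexHull ℝ _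
  have hlt : inner ℝ n b < inner ℝ n a := by
    obtain ⟨u, hu⟩ := C.interior_body_nonempty
    have h1 := inner_lt_of_mem_interior hn ha.2 hu
    have h2 := inner_lt_of_mem_interior (neg_ne_zero.mpr hn) hb.2 hu
    rw [inner_neg_left, inner_neg_left] at h2
    linarith
  have hmem : ∀ c x : Plane, x ∈ AffineSubspace.mk' c (ℝ ∙ n)ᗮ ↔ inner ℝ n x = inner ℝ n c := by
    intro c x
    rw [AffineSubspace.mem_mk', Submodule.mem_orthogonal_singleton_iff_inner_right, vsub_eq_sub,
      inner_sub_right, sub_eq_zero]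
  refine ⟨a, b, rfl, AffineSubspace.mk' a (ℝ ∙ n)ᗮ, AffineSubspace.mk' b (ℝ ∙ n)ᗮ,
    ⟨?_, n, hn, ?_, fun x hx => ha.2 x (hsub hx)⟩,
    ⟨?_, -n, neg_ne_zero.mpr hn, ?_, fun x hx => hb.2 x (hsub hx)⟩, ?_, ?_⟩
  · rw [← frontier_body]; exact mem_frontier_of_mem_face hn ha
  · ext x; exact hmem a x
  · rw [← frontier_body]; exact mem_frontier_of_mem_face (neg_ne_zero.mpr hn) hb
  · ext x
    simp only [SetLike.mem_coe, hmem, mem_ofPred_eq, inner_neg_left, neg_inj]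
  · intro h
    have h1 : a ∈ AffineSubspace.mk' b (ℝ ∙ n)ᗮ := h ▸ AffineSubspace.self_mem_mk' a _
    exact hlt.ne' ((hmem b a).mp h1)
  · rw [AffineSubspace.parallel_iff_direction_eq_and_eq_bot_iff_eq_bot,
      AffineSubspace.direction_mk', AffineSubspace.direction_mk']
    refine ⟨rfl, ?_⟩
    rw [← AffineSubspace.coe_eq_bot_iff, ← AffineSubspace.coe_eq_bot_iff]
    exact iff_of_false (AffineSubspace.mk'_nonempty _ _).ne_empty
      (AffineSubspace.mk'_nonempty _ _).ne_empty

/-- Along `b - a`, the points `c` and `d` have parameters `≥ 0`, and their convex combination `a`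
has parameter `0`. Both weighted terms must then vanish. -/
theorem eq_or_eq_of_segment_eq_left {a b c d : Plane} (h : segment ℝ a b = segment ℝ c d) :
    a = c ∨ a = d := by
  have hc : c ∈ segment ℝ a b := h ▸ left_mem_segment ℝ c d
  have hd : d ∈ segment ℝ a b := h ▸ right_mem_segment ℝ c d
  have ha : a ∈ segment ℝ c d := h ▸ left_mem_segment ℝ a b
  rw [segment_eq_image'] at hc hd ha
  obtain ⟨s, hs, rfl⟩ := hc
  obtain ⟨s', hs', rfl⟩ := hd
  obtain ⟨r, hr, hra⟩ := ha
  have h0 : ((1 - r) * s + r * s') • (b - a) = 0 := by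
    calc _ = (a + s • (b - a) + r • (a + s' • (b - a) - (a + s • (b - a)))) - a := by module
      _ = 0 := by rw [sub_eq_zero]; exact hra
  rcases smul_eq_zero.mp h0 with h1 | h1
  · have hA : 0 ≤ (1 - r) * s := mul_nonneg (by linarith [hr.2]) hs.1
    have hB : 0 ≤ r * s' := mul_nonneg hr.1 hs'.1
    have hA0 : (1 - r) * s = 0 := by linarith
    have hB0 : r * s' = 0 := by linarith
    rcases mul_eq_zero.mp hA0 with h2 | h2
    · right
      have : s' = 0 := by
        have : r = 1 := by linarith
        simpa [this] using hB0
      simp [this]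
    · left; simp [h2]
  · left; simp [h1]

theorem eq_and_eq_or_of_segment_eq {a b c d : Plane} (hab : a ≠ b)
    (h : segment ℝ a b = segment ℝ c d) : a = c ∧ b = d ∨ a = d ∧ b = c := by
  have h2 : segment ℝ b a = segment ℝ c d := by rw [segment_symm, h]
  rcases eq_or_eq_of_segment_eq_left h with h3 | h3 <;>
    rcases eq_or_eq_of_segment_eq_left h2 with h4 | h4
  · exact absurd (h3.trans h4.symm) hab
  · exact Or.inl ⟨h3, h4⟩
  · exact Or.inr ⟨h3, h4⟩
  · exact absurd (h3.trans h4.symm) hab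

/-- No chord in direction `n` has its line through `u`. -/
theorem not_cross_eq_zero {K : Set Plane} {u n a b : Plane}
    (h : ChordsAside K u n ∨ ChordsAside K u (-n)) (ha : a ∈ face K n) (hb : b ∈ face K (-n)) :
    cross (a - u) (b - u) ≠ 0 := by
  rcases h with h | h
  · exact (h a ha b hb).ne'
  · exact (h.cross_neg ha hb).ne

theorem neg_dir_sub_one (t : ℝ) : -dir (t - 1) = dir t := by
  rw [← dir_add_one, sub_add_cancel]

/-- Affine diameters separated by nonzero directions are distinct. -/
theorem segment_ne_segment {K : Set Plane} {u a b c d : Plane} {α s r t : ℝ}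
    (hα : ChordsAside K u (dir α) ∨ ChordsAside K u (-dir α))
    (hr : ChordsAside K u (dir r) ∨ ChordsAside K u (-dir r))
    (hαs : α ≤ s) (hsr : s ≤ r) (hrt : r ≤ t) (htα : t < α + 1)
    (ha : a ∈ face K (dir s)) (hb : b ∈ face K (-dir s)) (hab : a ≠ b)
    (hc : c ∈ face K (dir t)) (hd : d ∈ face K (-dir t)) (h0 : cross (a - u) (b - u) = 0) :
    segment ℝ a b ≠ segment ℝ c d := by
  intro hseg
  have hst : s < t := by
    rcases eq_or_lt_of_le (hsr.trans hrt) with h | h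
    · have hrs : r = s := le_antisymm (hrt.trans h.symm.le) hsr
      rw [hrs] at hr
      exact absurd h0 (not_cross_eq_zero hr ha hb)
    · exact h
  rcases eq_and_eq_or_of_segment_eq hab hseg with ⟨rfl, rfl⟩ | ⟨rfl, rfl⟩
  -- Same orientation: both ends lie in the faces for `s` and for `t`, hence in those for `r`,
  -- although no chord for `r` is aligned with `u`.
  · refine not_cross_eq_zero hr (mem_face_of_le_of_le ha hc hsr hrt (by linarith)) ?_ h0
    rw [← dir_add_one] at hb hd ⊢
    exact mem_face_of_le_of_le hb hd (by linarith) (by linarith) (by linarith)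
  -- Opposite orientation: the chord belongs to the directions `t - 1` and `s`, and `t - 1 < α ≤ s`,
  -- so `α` gives the contradiction.
  · rw [← neg_dir_sub_one, neg_neg] at hd
    rw [← neg_dir_sub_one] at hc
    refine not_cross_eq_zero hα
      (mem_face_of_le_of_le hd ha (by linarith) hαs (by linarith)) ?_ h0
    rw [← dir_add_one] at hb hc ⊢
    exact mem_face_of_le_of_le hc hb (by linarith) (by linarith) (by linarith)

/-! ### Cantor schemes of intervals -/

/-- If every interval of a family contains two disjoint intervals of the family sharing one
endpoint each with it, and every interval of the family meets the closed set `Z`, then `Z` contains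
continuum many points, any two of which are separated by an endpoint. -/
theorem exists_separated_family {I : Set (ℝ × ℝ)} {Z : Set ℝ} (hZ : IsClosed Z)
    (hmeet : ∀ p ∈ I, (Icc p.1 p.2 ∩ Z).Nonempty)
    (hsplit : ∀ p ∈ I, ∃ γ δ : ℝ, p.1 < γ ∧ γ < δ ∧ δ < p.2 ∧ (p.1, γ) ∈ I ∧ (δ, p.2) ∈ I)
    {p₀ : ℝ × ℝ} (hp₀ : p₀ ∈ I) :
    ∃ z : (ℕ → Bool) → ℝ, (∀ x, z x ∈ Icc p₀.1 p₀.2 ∩ Z) ∧ ∀ x y, x ≠ y →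
      ∃ p ∈ I, z x ≤ p.2 ∧ p.2 ≤ z y ∨ z y ≤ p.2 ∧ p.2 ≤ z x := by
  choose! γ δ h1 h2 h3 h4 h5 using hsplit
  let step : I → Bool → I := fun p i =>
    if i then ⟨(δ p, p.1.2), h5 p p.2⟩ else ⟨(p.1.1, γ p), h4 p p.2⟩
  let node : (ℕ → Bool) → ℕ → I := fun x n => Nat.rec ⟨p₀, hp₀⟩ (fun k q => step q (x k)) n
  have hnode : ∀ x k, node x (k + 1) = step (node x k) (x k) := fun _ _ => rfl
  have hstep : ∀ (p : I) i, Icc (step p i).1.1 (step p i).1.2 ⊆ Icc p.1.1 p.1.2 := by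
    intro p i
    have e1 := h1 p p.2
    have e2 := h2 p p.2
    have e3 := h3 p p.2
    cases i
    · exact Icc_subset_Icc_right (by simp [step]; linarith)
    · exact Icc_subset_Icc_left (by simp [step]; linarith)
  have hne : ∀ x, (⋂ k, Icc (node x k).1.1 (node x k).1.2 ∩ Z).Nonempty := fun x =>
    IsCompact.nonempty_iInter_of_sequence_nonempty_isCompact_isClosed _
      (fun k => inter_subset_inter_left _ (hstep _ _)) (fun k => hmeet _ (node x k).2)
      (isCompact_Icc.inter_right hZ) fun k => isClosed_Icc.inter hZ
  choose z hz using hne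
  simp only [mem_iInter] at hz
  refine ⟨z, fun x => hz x 0, ?_⟩
  -- At the first index where they differ, `x` goes left and `y` right. The right end `γ` of the
  -- left child separates them, and that child is itself in the family.
  have key : ∀ x y n, (∀ k < n, x k = y k) → x n = false → y n = true →
      ∃ p ∈ I, z x ≤ p.2 ∧ p.2 ≤ z y := by
    intro x y n hk hx hy
    have hn : ∀ m ≤ n, node x m = node y m := by
      intro m
      induction m with
      | zero => exact fun _ => rfl
      | succ m ih =>
        intro hm
        rw [hnode, hnode, ih (by omega), hk m (by omega)]
    have ex := (hz x (n + 1)).1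
    have ey := (hz y (n + 1)).1
    rw [hnode, hx, hn n le_rfl] at ex
    rw [hnode, hy] at ey
    simp only [step, if_true, Bool.false_eq_true, if_false] at ex ey
    exact ⟨_, h4 _ (node y n).2, ex.2, (h2 _ (node y n).2).le.trans ey.1⟩
  intro x y hxy
  have hex : ∃ n, x n ≠ y n := Function.ne_iff.mp hxy
  classical
  have hmin : ∀ k < Nat.find hex, x k = y k := fun k hk => not_not.mp (Nat.find_min hex hk)
  have hne := Nat.find_spec hex
  cases hx : x (Nat.find hex) <;> cases hy : y (Nat.find hex)
  · exact absurd (hx.trans hy.symm) hne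
  · obtain ⟨p, hp, h⟩ := key x y _ hmin hx hy
    exact ⟨p, hp, Or.inl h⟩
  · obtain ⟨p, hp, h⟩ := key y x _ (fun k hk => (hmin k hk).symm) hy hx
    exact ⟨p, hp, Or.inr h⟩
  · exact absurd (hx.trans hy.symm) hne

/-! ### Counting the affine diameters through a point -/

theorem mk_affineDiameters_le (C : ConvexCurve) (u : Plane) :
    Cardinal.mk {S : Set Plane | C.IsAffineDiameter S ∧ u ∈ S} ≤ Cardinal.continuum := by
  have hP : Cardinal.mk Plane ≤ Cardinal.continuum := by
    rw [Cardinal.mk_congr (WithLp.equiv 2 (Fin 2 → ℝ))]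
    simp only [Cardinal.mk_pi, Cardinal.mk_real, Cardinal.prod_const, Cardinal.mk_fin,
      Cardinal.lift_id, Nat.cast_ofNat]
    exact_mod_cast (pow_two Cardinal.continuum ▸ Cardinal.continuum_mul_self).le
  have hsub : {S : Set Plane | C.IsAffineDiameter S ∧ u ∈ S} ⊆
      range fun p : Plane × Plane => segment ℝ p.1 p.2 := by
    rintro S ⟨⟨a, b, rfl, -⟩, -⟩
    exact ⟨(a, b), rfl⟩
  refine (Cardinal.mk_le_mk_of_subset hsub).trans (Cardinal.mk_range_le.trans ?_)
  rw [← Cardinal.mul_def, ← Cardinal.continuum_mul_self]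
  exact mul_le_mul' hP hP

/-- The pairs of rational directions between which the chords of `C` pass over `u` from one given
side to the other. -/
def signChanges (C : ConvexCurve) (u : Plane) : Set (ℝ × ℝ) :=
  {p | ∃ α β : ℚ, p = ((α : ℝ), (β : ℝ)) ∧ α < β ∧ ChordsAside C.body u (-dir α) ∧
    ChordsAside C.body u (dir β)}

theorem exists_mem_zeros_of_chordsAside {C : ConvexCurve} {u : Plane} {α β : ℝ} (hαβ : α < β)
    (hα : ChordsAside C.body u (-dir α)) (hβ : ChordsAside C.body u (dir β)) :
    ∃ t, α < t ∧ t < β ∧ t ∈ C.zeros u := by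
  obtain ⟨t, ht, h0⟩ := exists_mem_zeros hαβ.le hα.exists_cross_nonpos hβ.exists_cross_nonneg
  have h0' := h0
  obtain ⟨a, ha, b, hb, hab⟩ := h0'
  refine ⟨t, lt_of_le_of_ne ht.1 ?_, lt_of_le_of_ne ht.2 ?_, h0⟩
  · rintro rfl
    exact not_cross_eq_zero (Or.inr hα) ha hb hab
  · rintro rfl
    exact not_cross_eq_zero (Or.inl hβ) ha hb hab

/-- Pairs of end points give the upper bound; the Cantor scheme started at `(α, β)` gives the lower
one. The width below `1` excludes the same segment being met again with its ends reversed. -/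
theorem mk_affineDiameters_eq {C : ConvexCurve} {u : Plane} (hu : u ∈ interior C.body)
    {α β : ℚ} (hαβ : α < β) (hβα : β < α + 1) (hα : ChordsAside C.body u (-dir α))
    (hβ : ChordsAside C.body u (dir β))
    (hsplit : ∀ α β : ℚ, α < β → ChordsAside C.body u (-dir α) → ChordsAside C.body u (dir β) →
      ∃ γ δ : ℚ, α < γ ∧ γ < δ ∧ δ < β ∧ ChordsAside C.body u (dir γ) ∧
        ChordsAside C.body u (-dir δ)) :
    Cardinal.mk {S : Set Plane | C.IsAffineDiameter S ∧ u ∈ S} = Cardinal.continuum := by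
  refine le_antisymm (C.mk_affineDiameters_le u) ?_
  obtain ⟨z, hz, hsep⟩ := exists_separated_family (I := C.signChanges u) (C.isClosed_zeros u)
    (by
      rintro _ ⟨α, β, rfl, h, hα, hβ⟩
      obtain ⟨t, h1, h2, h3⟩ := exists_mem_zeros_of_chordsAside (Rat.cast_lt.mpr h) hα hβ
      exact ⟨t, ⟨h1.le, h2.le⟩, h3⟩)
    (by
      rintro _ ⟨α, β, rfl, h, hα, hβ⟩
      obtain ⟨γ, δ, h1, h2, h3, h4, h5⟩ := hsplit α β h hα hβ
      exact ⟨γ, δ, Rat.cast_lt.mpr h1, Rat.cast_lt.mpr h2, Rat.cast_lt.mpr h3,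
        ⟨α, γ, rfl, h1, hα, h4⟩, ⟨δ, β, rfl, h3, h5, hβ⟩⟩)
    (p₀ := ((α : ℝ), (β : ℝ))) ⟨α, β, rfl, hαβ, hα, hβ⟩
  have hz' := fun x => (hz x).2
  choose a ha b hb hab using hz'
  have hβα' : (β : ℝ) < α + 1 := by exact_mod_cast hβα
  have hne : ∀ x, a x ≠ b x := by
    intro x h
    have h1 := inner_lt_of_mem_interior (dir_ne_zero _) (ha x).2 hu
    have h2 := inner_lt_of_mem_interior (neg_ne_zero.mpr (dir_ne_zero _)) (hb x).2 hu
    rw [inner_neg_left, inner_neg_left, ← h] at h2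
    linarith
  have hmem : ∀ x, segment ℝ (a x) (b x) ∈ {S : Set Plane | C.IsAffineDiameter S ∧ u ∈ S} := by
    intro x
    refine ⟨isAffineDiameter_segment (dir_ne_zero _) (ha x) (hb x), ?_⟩
    obtain ⟨τ, h0, h1, h⟩ := exists_eq_of_cross_eq_zero (dir_ne_zero _) (ha x) (hb x) hu (hab x)
    exact ⟨1 - τ, τ, by linarith, h0.le, by ring, h.symm⟩
  have hlt : ∀ x y, (∃ p ∈ C.signChanges u, z x ≤ p.2 ∧ p.2 ≤ z y) →
      segment ℝ (a x) (b x) ≠ segment ℝ (a y) (b y) := by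
    rintro x y ⟨_, ⟨_, r, rfl, -, -, hr⟩, h1, h2⟩
    exact segment_ne_segment (Or.inr hα) (Or.inl hr) (hz x).1.1 h1 h2
      ((hz y).1.2.trans_lt hβα') (ha x) (hb x) (hne x) (ha y) (hb y) (hab x)
  have hinj : Function.Injective fun x => (⟨_, hmem x⟩ :
      {S : Set Plane | C.IsAffineDiameter S ∧ u ∈ S}) := by
    intro x y hxy
    have hxy' : segment ℝ (a x) (b x) = segment ℝ (a y) (b y) := congrArg Subtype.val hxy
    by_contra hne'
    obtain ⟨p, hp, h | h⟩ := hsep x y hne'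
    · exact hlt x y ⟨p, hp, h⟩ hxy'
    · exact hlt y x ⟨p, hp, h⟩ hxy'.symm
  have hbool : Cardinal.mk (ℕ → Bool) = Cardinal.continuum := by simp
  exact hbool ▸ Cardinal.mk_le_of_injective hinj

/-! ### Genericity -/

/-- The set `B ∪ (closure B)ᶜ` is open and dense, and on it membership in `A` forces membership in
`B`. Nothing is needed of `A` itself. -/
theorem eventually_residual_imp {X : Type*} [TopologicalSpace X] {A B : Set X} (hB : IsOpen B)
    (hAB : A ⊆ closure B) : ∀ᶠ x in residual X, x ∈ A → x ∈ B := by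
  refine mem_of_superset (residual_of_dense_open (hB.union (isClosed_closure (s := B)).isOpen_compl) ?_) ?_
  · intro x
    by_cases hx : x ∈ closure B
    · exact closure_mono subset_union_left hx
    · exact subset_closure (Or.inr hx)
  · rintro x (hx | hx) hA
    · exact hx
    · exact absurd (hAB hA) hx

theorem isOpen_setOf_curve_chordsAside (u n : Plane) :
    IsOpen {C : ConvexCurve | ChordsAside C.body u n} :=
  isOpen_setOf_chordsAside.preimage
    (f := fun C : ConvexCurve => ((C, u, n) : ConvexCurve × Plane × Plane)) (by fun_prop)

theorem isOpen_setOf_point_chordsAside (C : ConvexCurve) (n : Plane) :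
    IsOpen {u : Plane | ChordsAside C.body u n} :=
  isOpen_setOf_chordsAside.preimage
    (f := fun u : Plane => ((C, u, n) : ConvexCurve × Plane × Plane)) (by fun_prop)

/-- Within less than half a turn, the chords of `C` pass over `u` from one given side to the
other. -/
def HasShortSignChange (C : ConvexCurve) (u : Plane) : Prop :=
  ∃ α β : ℚ, α < β ∧ β < α + 1 ∧ ChordsAside C.body u (-dir α) ∧ ChordsAside C.body u (dir β)

/-- The sign change of `C` at `u` between `α` and `β` splits into three. -/
def SplitsBetween (C : ConvexCurve) (u : Plane) (α β : ℚ) : Prop :=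
  ∃ γ δ : ℚ, α < γ ∧ γ < δ ∧ δ < β ∧ ChordsAside C.body u (dir γ) ∧ ChordsAside C.body u (-dir δ)

theorem isOpen_setOf_exists_and {X : Type*} [TopologicalSpace X] {P : ℚ → ℚ → Prop}
    {Q R : ℚ → X → Prop} (hQ : ∀ γ, IsOpen {x | Q γ x}) (hR : ∀ δ, IsOpen {x | R δ x}) :
    IsOpen {x | ∃ γ δ, P γ δ ∧ Q γ x ∧ R δ x} := by
  simp only [ofPred_exists]
  exact isOpen_iUnion fun γ => isOpen_iUnion fun δ =>
    isOpen_const.inter ((hQ γ).inter (hR δ))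

theorem eventually_residual_hasShortSignChange (u : Plane) :
    ∀ᶠ C : ConvexCurve in residual ConvexCurve, u ∈ interior C.body → C.HasShortSignChange u := by
  refine eventually_residual_imp (A := {C : ConvexCurve | u ∈ interior C.body})
    (B := {C : ConvexCurve | C.HasShortSignChange u}) ?_ ?_
  · simpa only [HasShortSignChange, and_assoc] using
      isOpen_setOf_exists_and (P := fun α β => α < β ∧ β < α + 1)
        (fun γ => isOpen_setOf_curve_chordsAside u (-dir γ))
        (fun γ => isOpen_setOf_curve_chordsAside u (dir γ))
  · intro C hu
    obtain ⟨t, ht⟩ := C.zeros_nonempty u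
    refine Metric.mem_closure_iff.mpr fun ε hε => ?_
    obtain ⟨D, hD, γ, δ, h1, h2, h3, h4, h5, h6⟩ :=
      exists_dist_lt_chordsAside hu ht hε (κ := 1 / 2) (by norm_num)
    have hlt : (γ : ℝ) < δ := by linarith
    have hlt' : (δ : ℝ) < γ + 1 := by linarith
    -- The perturbation gives positive at `γ` and negative at `δ`; a half turn reverses both signs
    -- into the required order.
    refine ⟨D, ⟨γ + 1, δ + 1, ?_, ?_, ?_, ?_⟩, by rwa [dist_comm]⟩
    · have : γ < δ := by exact_mod_cast hlt
      linarith
    · have : δ < γ + 1 := by exact_mod_cast hlt'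
      linarith
    · push_cast; rwa [dir_add_one, neg_neg]
    · push_cast; rwa [dir_add_one]

theorem eventually_residual_splitsBetween (u : Plane) (α β : ℚ) :
    ∀ᶠ C : ConvexCurve in residual ConvexCurve, (u ∈ interior C.body ∧ α < β ∧
      ChordsAside C.body u (-dir α) ∧ ChordsAside C.body u (dir β)) → C.SplitsBetween u α β := by
  refine eventually_residual_imp (A := {C : ConvexCurve | u ∈ interior C.body ∧ α < β ∧
      ChordsAside C.body u (-dir α) ∧ ChordsAside C.body u (dir β)})
    (B := {C : ConvexCurve | C.SplitsBetween u α β}) ?_ ?_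
  · simpa only [SplitsBetween, and_assoc] using
      isOpen_setOf_exists_and (P := fun γ δ => α < γ ∧ γ < δ ∧ δ < β)
        (fun γ => isOpen_setOf_curve_chordsAside u (dir γ))
        (fun γ => isOpen_setOf_curve_chordsAside u (-dir γ))
  · rintro C ⟨hu, hαβ, hα, hβ⟩
    obtain ⟨t, hαt, htβ, ht⟩ := exists_mem_zeros_of_chordsAside (Rat.cast_lt.mpr hαβ) hα hβ
    refine Metric.mem_closure_iff.mpr fun ε hε => ?_
    -- This `κ` keeps `γ` and `δ` strictly between `α` and `β`.
    obtain ⟨D, hD, γ, δ, h1, h2, h3, h4, h5, h6⟩ := exists_dist_lt_chordsAside hu ht hε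
      (κ := min (t - α) (β - t)) (lt_min (by linarith) (by linarith))
    have e1 := min_le_left (t - α) (β - t)
    have e2 := min_le_right (t - α) (β - t)
    have g1 : (α : ℝ) < γ := by linarith
    have g2 : (γ : ℝ) < δ := by linarith
    have g3 : (δ : ℝ) < β := by linarith
    exact ⟨D, ⟨γ, δ, by exact_mod_cast g1, by exact_mod_cast g2, by exact_mod_cast g3, h5, h6⟩,
      by rwa [dist_comm]⟩

/-- An implication between open conditions that holds at a dense set of points of the plane holds
at most points of a body. -/
theorem eventually_residual_body {C : ConvexCurve} {d : ℕ → Plane} (hd : DenseRange d)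
    {A B : Set Plane} (hA : IsOpen A) (hB : IsOpen B)
    (h : ∀ i, d i ∈ interior C.body → d i ∈ A → d i ∈ B) :
    ∀ᶠ u : C.body in residual C.body, (u : Plane) ∈ interior C.body ∩ A → (u : Plane) ∈ B := by
  refine eventually_residual_imp (A := {u : C.body | (u : Plane) ∈ interior C.body ∩ A})
    (hB.preimage continuous_subtype_val) fun u hu => Metric.mem_closure_iff.mpr fun ε hε => ?_
  obtain ⟨i, hi⟩ := hd.exists_mem_open ((isOpen_interior.inter hA).inter isOpen_ball)
    ⟨(u : Plane), hu, mem_ball_self hε⟩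
  refine ⟨⟨d i, interior_subset hi.1.1⟩, h i hi.1.1 hi.1.2, ?_⟩
  rw [dist_comm]
  exact hi.2

theorem eventually_residual_mem_interior (C : ConvexCurve) :
    ∀ᶠ u : C.body in residual C.body, (u : Plane) ∈ interior C.body := by
  have := eventually_residual_imp (X := C.body) (A := univ)
    (isOpen_interior.preimage continuous_subtype_val : IsOpen {u : C.body | (u : Plane) ∈
      interior C.body}) fun u _ => by
        rw [closure_subtype]
        have hu : (u : Plane) ∈ closure (interior C.body) := by
          rw [C.convex_body.closure_interior_eq_closure_of_nonempty_interior
            C.interior_body_nonempty]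
          exact subset_closure u.2
        refine closure_mono (fun x hx => ?_) hu
        exact ⟨⟨x, interior_subset hx⟩, hx, rfl⟩
  exact this.mono fun u hu => hu (mem_univ u)

/-- For most curves, most points of the body lie in continuum many affine diameters. -/
theorem mem_residual_mk_affineDiameters_eq :
    {C : ConvexCurve |
      {u : C.body | Cardinal.mk {S : Set Plane | C.IsAffineDiameter S ∧ (u : Plane) ∈ S} =
        Cardinal.continuum} ∈ residual C.body} ∈ residual ConvexCurve := by
  have hd := TopologicalSpace.denseRange_denseSeq Plane
  set d := TopologicalSpace.denseSeq Plane
  -- Restricting to a dense sequence of points and rational directions leaves countably many generic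
  -- conditions on the curve.
  have H1 := eventually_countable_forall.mpr fun i : ℕ =>
    eventually_residual_hasShortSignChange (d i)
  have H2 := eventually_countable_forall.mpr fun i : ℕ => eventually_countable_forall.mpr
    fun α : ℚ => eventually_countable_forall.mpr fun β : ℚ =>
      eventually_residual_splitsBetween (d i) α β
  filter_upwards [H1, H2] with C hC1 hC2
  have G1 := eventually_residual_body (C := C) hd (A := Set.univ)
    (B := {u | C.HasShortSignChange u}) isOpen_univ
    (by
      simpa only [HasShortSignChange, and_assoc] using
        isOpen_setOf_exists_and (P := fun α β => α < β ∧ β < α + 1)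
          (fun γ => C.isOpen_setOf_point_chordsAside (-dir γ))
          (fun γ => C.isOpen_setOf_point_chordsAside (dir γ)))
    fun i hi _ => hC1 i hi
  have G2 := eventually_countable_forall.mpr fun α : ℚ => eventually_countable_forall.mpr
    fun β : ℚ => eventually_residual_body (C := C) hd
      (A := {u | α < β ∧ ChordsAside C.body u (-dir α) ∧ ChordsAside C.body u (dir β)})
      (B := {u | C.SplitsBetween u α β})
      (isOpen_const.inter ((C.isOpen_setOf_point_chordsAside _).inter
        (C.isOpen_setOf_point_chordsAside _)))
      (by
        simpa only [SplitsBetween, and_assoc] using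
          isOpen_setOf_exists_and (P := fun γ δ => α < γ ∧ γ < δ ∧ δ < β)
            (fun γ => C.isOpen_setOf_point_chordsAside (dir γ))
            (fun γ => C.isOpen_setOf_point_chordsAside (-dir γ)))
      fun i hi h => hC2 i α β ⟨hi, h⟩
  filter_upwards [C.eventually_residual_mem_interior, G1, G2] with u hu h1 h2
  obtain ⟨α, β, hαβ, hβα, hα, hβ⟩ := h1 ⟨hu, Set.mem_univ _⟩
  exact mk_affineDiameters_eq hu hαβ hβα hα hβ fun γ δ hγδ hγ hδ => h2 γ δ ⟨hu, hγδ, hγ, hδ⟩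

end ConvexCurve

theorem theorem1p3 :
    {C : ConvexCurve |
      {u : C.body | Cardinal.mk {S : Set Plane | C.IsAffineDiameter S ∧ (u : Plane) ∈ S} =
        Cardinal.continuum} ∈ residual C.body} ∈ residual ConvexCurve :=
  ConvexCurve.mem_residual_mk_affineDiameters_eq
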